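/- Let $L$ and $R$ be disjoint vertex sets with $|L|=|R|=n$. Alice is given an edge set $E_A\subseteq L\times R$ and Bob is given an edge set $E_B\subseteq L\times R$; let $G_\cap=(L\cup R,\,E_A\cap E_B)$ be the intersection graph. A public-coin protocol is a probability distribution over deterministic two-party communication protocols; its cost is the maximum number of bits exchanged, over all inputs and all outcomes of the public randomness; it decides a property of $G_\cap$ with error $\varepsilon$ if on every input pair $(E_A,E_B)$ it gives the wrong answer with probability at most $\varepsilon$. Then for every constant $0\le\varepsilon<1/2$ there is a constant $c>0$, depending only on $\varepsilon$, such that for all $n$: (i) every public-coin protocol that decides with error $\varepsilon$ whether $G_\cap$ has a perfect matching has cost at least $c\,n^2$; (ii) every public-coin protocol that decides with error $\varepsilon$ whether $G_\cap$ has exactly one perfect matching has cost at least $c\,n^2$. That is, both problems require $\Omega(n^2)$ bits of communication, even if public randomness is allowed. -/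

import Mathlib

/-- Deterministic two-party communication protocols (protocol trees) with Boolean output.
Alice holds an input in `X`, Bob an input in `Y`. At an inner node the indicated player announces
one bit, computed from their own input (and the position in the tree, i.e. the transcript so far),
and both players move to the corresponding child. A leaf carries the output. -/
inductive DetProtocol (X Y : Type) : Type
  | output (b : Bool) : DetProtocol X Y
  | alice (msg : X → Bool) (next : Bool → DetProtocol X Y) : DetProtocol X Y
  | bob (msg : Y → Bool) (next : Bool → DetProtocol X Y) : DetProtocol X Y

namespace DetProtocol

variable {X Y : Type}

/-- The output of the protocol on the inputs `x` (Alice) and `y` (Bob). -/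
def run : DetProtocol X Y → X → Y → Bool
  | output b, _, _ => b
  | alice msg next, x, y => (next (msg x)).run x y
  | bob msg next, x, y => (next (msg y)).run x y

/-- The communication cost: the maximal number of bits exchanged, i.e. the depth of the tree. -/
def cost : DetProtocol X Y → ℕ
  | output _ => 0
  | alice _ next => max (next false).cost (next true).cost + 1
  | bob _ next => max (next false).cost (next true).cost + 1

end DetProtocol

/-- A public-coin randomized protocol: a probability distribution over deterministic protocols
(the public random string selects the deterministic protocol that both players follow).
For finite `X` and `Y` there are only countably many protocol trees, so a discrete distribution
is no restriction; private coins are a special case of public ones, and a deterministic protocol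
is a point mass. -/
abbrev PublicCoinProtocol (X Y : Type) : Type := PMF (DetProtocol X Y)

namespace PublicCoinProtocol

variable {X Y : Type}

/-- The protocol never exchanges more than `b` bits, for any inputs and any outcome of the public
randomness. -/
def CostAtMost (P : PublicCoinProtocol X Y) (b : ℕ) : Prop :=
  ∀ π ∈ P.support, π.cost ≤ b

/-- The protocol decides the predicate `f`: on every pair of inputs, it answers wrongly with
probability at most `ε`. -/
def Decides (P : PublicCoinProtocol X Y) (f : X → Y → Prop) (ε : ℝ) : Prop :=
  ∀ x y, P.toOuterMeasure {π | ¬ (π.run x y = true ↔ f x y)} ≤ ENNReal.ofReal ε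

end PublicCoinProtocol

/-- The edge set of a bipartite graph with sides `L = R = Fin n`. -/
abbrev BipEdges (n : ℕ) : Type := Set (Fin n × Fin n)

/-- The bipartite graph on the vertex set `L ∪ R` (disjoint union) with edge set `E ⊆ L × R`. -/
def bipGraph {n : ℕ} (E : BipEdges n) : SimpleGraph (Fin n ⊕ Fin n) :=
  SimpleGraph.fromRel fun u v => ∃ i j, (i, j) ∈ E ∧ u = Sum.inl i ∧ v = Sum.inr j

/-- Bipartite perfect matching on the intersection graph `(L ∪ R, EA ∩ EB)`. -/
def IntersectionBPM {n : ℕ} (EA EB : BipEdges n) : Prop :=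
  ∃ M : (bipGraph (EA ∩ EB)).Subgraph, M.IsPerfectMatching

/-- Unique bipartite perfect matching on the intersection graph `(L ∪ R, EA ∩ EB)`: the graph has
exactly one perfect matching. -/
def IntersectionUBPM {n : ℕ} (EA EB : BipEdges n) : Prop :=
  ∃! M : (bipGraph (EA ∩ EB)).Subgraph, M.IsPerfectMatching

/-! Both problems contain unique disjointness on about n²/4 points. Two fixed vertex-disjoint paths
cover all vertices; one has a surplus left vertex and the other a surplus right vertex. The points
are the possible edges from a left vertex of the first to a right vertex of the second. Without such
an edge Hall's condition fails (`not_forall_twoPaths`); with exactly one, the matching is forced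
from the path ends inwards (`perm_eq_twoPathsMatch`).

The lower bound for unique disjointness is a corruption argument. Given the random split `s`, the
two sets of a disjoint pair are independent, so a rectangle has mass a product of means. If it
contains far fewer pairs meeting in `i`, then `f` or `g` is biased in direction `i`
(`corruption_local`). The level-one inequality (`sum_sq_expect_sign_mul_le`) bounds the total
squared bias by entropy, so only exponentially small rectangles avoid the intersecting pairs
(`disjointMean_le_mul_add_exp`).

A protocol of cost `b` splits its rejected pairs into at most `2 ^ b` rectangles. Since the
corruption bound loses a factor 12, it is applied to the `k`-th power of the rejection probability,
as if `k` independent runs all had to reject; `k` depends only on `ε` (`pow_le_of_decides`). -/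

/-! ### Corruption bound for rectangles on the cube -/

section Cube

open Finset
open scoped BigOperators

variable {ι : Type*} [DecidableEq ι]

/-- The `i`-th Rademacher character of the cube of subsets. -/
noncomputable def subsetSign (i : ι) (x : Finset ι) : ℝ := if i ∈ x then -1 else 1

theorem abs_subsetSign (i : ι) (x : Finset ι) : |subsetSign i x| = 1 := by
  unfold subsetSign; split_ifs <;> simp

theorem inter_insert_cases (i : ι) (x s : Finset ι) :
    insert i x ∩ insert i s = insert i (x ∩ s) ∧ x.erase i ∩ insert i s = (x ∩ s).erase i ∧
      insert i x ∩ s.erase i = (x ∩ s).erase i ∧ x.erase i ∩ s.erase i = (x ∩ s).erase i := by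
  refine ⟨?_, ?_, ?_, ?_⟩ <;> ext j <;> by_cases hj : j = i <;> simp [hj]

variable [Fintype ι]

/-- Averaging over all subsets by pairing the subsets that differ only in `i`. -/
theorem expect_eq_expect_insert_erase (i : ι) (Φ : Finset ι → ℝ) :
    𝔼 s, Φ s = 𝔼 s, (Φ (insert i s) + Φ (s.erase i)) / 2 := by
  have hinv : Function.Involutive fun s : Finset ι => symmDiff s {i} := fun s => by
    simp
  have h1 : 𝔼 s, Φ s = 𝔼 s, Φ (symmDiff s {i}) :=
    (Fintype.expect_equiv hinv.toPerm _ _ (fun s => rfl)).symm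
  have h2 : ∀ s : Finset ι, Φ (insert i s) + Φ (s.erase i) = Φ s + Φ (symmDiff s {i}) := by
    intro s
    by_cases hi : i ∈ s
    · have : symmDiff s {i} = s.erase i := by
        ext j; by_cases hj : j = i <;> simp [mem_symmDiff, hj, hi]
      rw [this, insert_eq_of_mem hi]
    · have : symmDiff s {i} = insert i s := by
        ext j; by_cases hj : j = i <;> simp [mem_symmDiff, hj, hi]
      rw [this, erase_eq_of_notMem hi, add_comm]
  simp_rw [h2, ← expect_div, expect_add_distrib, ← h1]
  ring

theorem expect_exp_sum_sign (v : ι → ℝ) :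
    𝔼 x : Finset ι, Real.exp (∑ i, v i * subsetSign i x) = ∏ i, Real.cosh (v i) := by
  have h : ∀ x : Finset ι, Real.exp (∑ i, v i * subsetSign i x) =
      (∏ i ∈ x, Real.exp (-v i)) * ∏ i ∈ univ \ x, Real.exp (v i) := by
    intro x
    rw [Real.exp_sum, ← prod_sdiff (subset_univ x), mul_comm]
    congr 1
    · exact prod_congr rfl fun i hi => by simp [subsetSign, hi]
    · exact prod_congr rfl fun i hi => by
        simp only [mem_sdiff, mem_univ, true_and] at hi
        simp [subsetSign, hi]
  have hcosh : ∀ i, Real.cosh (v i) = (Real.exp (-v i) + Real.exp (v i)) / 2 := fun i => by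
    rw [Real.cosh_eq, add_comm]
  simp_rw [Fintype.expect_eq_sum_div_card, h, hcosh, prod_div_distrib, prod_add]
  simp

/-- The level-one inequality for `[0, 1]`-valued functions on the cube. -/
theorem sum_sq_expect_sign_mul_le (F : Finset ι → ℝ) (h0 : ∀ x, 0 ≤ F x) (h1 : ∀ x, F x ≤ 1) :
    ∑ i, (𝔼 x, subsetSign i x * F x) ^ 2 ≤ 2 * (𝔼 x, F x) * Real.negMulLog (𝔼 x, F x) := by
  set μ := 𝔼 x, F x with hμ
  have hμ0 : 0 ≤ μ := expect_nonneg fun x _ => h0 x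
  have hc : ∀ i, |𝔼 x, subsetSign i x * F x| ≤ μ := by
    intro i
    refine (abs_expect_le _ _).trans (expect_le_expect fun x _ => ?_)
    rw [abs_mul, abs_subsetSign, one_mul, abs_of_nonneg (h0 x)]
  rcases hμ0.eq_or_lt with h | hpos
  · have : ∀ i, 𝔼 x, subsetSign i x * F x = 0 := fun i =>
      abs_eq_zero.1 (le_antisymm (h ▸ hc i) (abs_nonneg _))
    simp [this, ← h]
  set v : ι → ℝ := fun i => (𝔼 x, subsetSign i x * F x) / μ with hv
  set t := ∑ i, v i ^ 2 with ht
  have hFW : 𝔼 x, F x * ∑ i, v i * subsetSign i x = t * μ := by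
    simp_rw [mul_sum]
    rw [expect_sum_comm, ht, sum_mul]
    refine sum_congr rfl fun i _ => ?_
    have : ∀ x, F x * (v i * subsetSign i x) = v i * (subsetSign i x * F x) := fun x => by ring
    simp_rw [this, ← mul_expect]
    have : 𝔼 x, subsetSign i x * F x = v i * μ := by simp only [hv]; field_simp
    rw [this]; ring
  -- Tangent line of `exp` at `t`, which is the mean of the linear form under the density `F / μ`.
  have hlow : Real.exp t * μ ≤ 𝔼 x, F x * Real.exp (∑ i, v i * subsetSign i x) := by
    have : Real.exp t * μ
        = 𝔼 x, F x * (Real.exp t * (1 + ((∑ i, v i * subsetSign i x) - t))) := by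
      have : ∀ x, F x * (Real.exp t * (1 + ((∑ i, v i * subsetSign i x) - t))) =
        Real.exp t * (F x * ∑ i, v i * subsetSign i x) + (Real.exp t * (1 - t)) * F x :=
        fun x => by ring
      simp_rw [this, expect_add_distrib, ← mul_expect, hFW, ← hμ]
      ring
    rw [this]
    refine expect_le_expect fun x _ => mul_le_mul_of_nonneg_left ?_ (h0 x)
    have := Real.add_one_le_exp ((∑ i, v i * subsetSign i x) - t)
    calc _ ≤ Real.exp t * Real.exp ((∑ i, v i * subsetSign i x) - t) := by gcongr; linarith
      _ = _ := by rw [← Real.exp_add]; congr 1; ring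
  have hup : 𝔼 x, F x * Real.exp (∑ i, v i * subsetSign i x) ≤ Real.exp (t / 2) := by
    calc _ ≤ 𝔼 x, Real.exp (∑ i, v i * subsetSign i x) :=
          expect_le_expect fun x _ => mul_le_of_le_one_left (Real.exp_pos _).le (h1 x)
      _ = ∏ i, Real.cosh (v i) := expect_exp_sum_sign v
      _ ≤ ∏ i, Real.exp (v i ^ 2 / 2) :=
          prod_le_prod (fun i _ => (Real.cosh_pos _).le) fun i _ => Real.cosh_le_exp_half_sq _
      _ = _ := by rw [← Real.exp_sum, ht, sum_div]
  have hlog : t / 2 ≤ -Real.log μ := by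
    have h3 : Real.exp (t / 2) * μ ≤ 1 := by
      have h4 := hlow.trans hup
      have h5 : Real.exp t = Real.exp (t / 2) * Real.exp (t / 2) := by
        rw [← Real.exp_add]; congr 1; ring
      rw [h5, mul_assoc] at h4
      exact le_of_mul_le_mul_left (by linarith) (Real.exp_pos (t / 2))
    have := Real.log_le_log (mul_pos (Real.exp_pos _) hpos) h3
    rw [Real.log_mul (Real.exp_pos _).ne' hpos.ne', Real.log_exp, Real.log_one] at this
    linarith
  have hsum : ∑ i, (𝔼 x, subsetSign i x * F x) ^ 2 = t * μ ^ 2 := by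
    rw [ht, sum_mul]
    refine sum_congr rfl fun i _ => ?_
    simp only [hv]; field_simp
  rw [hsum, Real.negMulLog]
  nlinarith [sq_nonneg μ]

/-- The mean of `f` over the subsets of `s`. -/
noncomputable def subsetMean (f : Finset ι → ℝ) (s : Finset ι) : ℝ := 𝔼 x, f (x ∩ s)

/-- The level-one coefficient of `f` in direction `i` over the subsets of `s`. -/
noncomputable def subsetCoeff (i : ι) (f : Finset ι → ℝ) (s : Finset ι) : ℝ :=
  𝔼 x, subsetSign i x * f (x ∩ s)

/-- This and the next three identities isolate coordinate `i`: everything reduces to the mean of `f`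
with `i` forced out and with `i` forced in. -/
theorem subsetMean_insert (i : ι) (f : Finset ι → ℝ) (s : Finset ι) :
    subsetMean f (insert i s) = (subsetMean (fun x => f (x.erase i)) s +
      subsetMean (fun x => f (insert i x)) s) / 2 := by
  unfold subsetMean
  rw [expect_eq_expect_insert_erase i, ← expect_div, expect_add_distrib, add_comm]
  simp_rw [(inter_insert_cases i _ s).1, (inter_insert_cases i _ s).2.1]

theorem subsetMean_erase (i : ι) (f : Finset ι → ℝ) (s : Finset ι) :
    subsetMean f (s.erase i) = subsetMean (fun x => f (x.erase i)) s := by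
  unfold subsetMean
  simp_rw [inter_erase]

theorem subsetCoeff_insert (i : ι) (f : Finset ι → ℝ) (s : Finset ι) :
    subsetCoeff i f (insert i s) = (subsetMean (fun x => f (x.erase i)) s -
      subsetMean (fun x => f (insert i x)) s) / 2 := by
  unfold subsetCoeff subsetMean
  rw [expect_eq_expect_insert_erase i, ← expect_div, ← expect_sub_distrib]
  simp_rw [(inter_insert_cases i _ s).1, (inter_insert_cases i _ s).2.1]
  simp [subsetSign, neg_add_eq_sub]

theorem subsetCoeff_erase (i : ι) (f : Finset ι → ℝ) (s : Finset ι) :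
    subsetCoeff i f (s.erase i) = 0 := by
  unfold subsetCoeff
  rw [expect_eq_expect_insert_erase i]
  simp_rw [(inter_insert_cases i _ s).2.2.1, (inter_insert_cases i _ s).2.2.2]
  simp [subsetSign]

theorem subsetMean_nonneg {f : Finset ι → ℝ} (h : ∀ x, 0 ≤ f x) (s : Finset ι) :
    0 ≤ subsetMean f s := expect_nonneg fun _ _ => h _

theorem sum_sq_subsetCoeff_le {f : Finset ι → ℝ} (h0 : ∀ x, 0 ≤ f x) (h1 : ∀ x, f x ≤ 1)
    (s : Finset ι) :
    ∑ i, (subsetCoeff i f s / subsetMean f s) ^ 2 * subsetMean f s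
      ≤ 2 * Real.negMulLog (subsetMean f s) := by
  have h := sum_sq_expect_sign_mul_le (fun x => f (x ∩ s)) (fun _ => h0 _) (fun _ => h1 _)
  change ∑ i, subsetCoeff i f s ^ 2 ≤ 2 * subsetMean f s * Real.negMulLog (subsetMean f s) at h
  -- At mean zero the quotients are 0 by convention, so a vanishing rectangle costs nothing.
  rcases (subsetMean_nonneg h0 s).eq_or_lt with hz | hpos
  · simp [← hz]
  · have : ∀ i, (subsetCoeff i f s / subsetMean f s) ^ 2 * subsetMean f s
        = subsetCoeff i f s ^ 2 / subsetMean f s := fun i => by field_simp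
    simp_rw [this, ← sum_div]
    rw [div_le_iff₀ hpos]
    linarith

/-- Here `p` and `q` are the conditional probabilities that each player's set contains the point. If
both are at least 1/4, the product term suffices. If one is below 1/4, its bias is bounded away from
zero, and the other player's bias helps when that one's probability is near 1. -/
theorem corruption_ratio_aux {p q : ℝ} (hp0 : 0 ≤ p) (hp1 : p ≤ 1) (hq0 : 0 ≤ q) (hq1 : q ≤ 1) :
    (2 - p - q) ≤ 24 * (p * q) +
      96 * ((1 - q) * (1 - 2 * p) ^ 2 + (1 - p) * (1 - 2 * q) ^ 2) := by
  have hA : 0 ≤ (1 - q) * (1 - 2 * p) ^ 2 := mul_nonneg (by linarith) (sq_nonneg _)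
  have hB : 0 ≤ (1 - p) * (1 - 2 * q) ^ 2 := mul_nonneg (by linarith) (sq_nonneg _)
  have hpq := mul_nonneg hp0 hq0
  have key : ∀ p q : ℝ, 0 ≤ p → p ≤ 1 / 4 → 0 ≤ q → q ≤ 1 →
      (2 - p - q) ≤ 96 * ((1 - q) * (1 - 2 * p) ^ 2 + (1 - p) * (1 - 2 * q) ^ 2) := by
    intro p q hp hp' hq hq'
    have h1 : (1 - q) * (1 / 4) ≤ (1 - q) * (1 - 2 * p) ^ 2 :=
      mul_le_mul_of_nonneg_left (by nlinarith) (by linarith)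
    have h2 : 0 ≤ (1 - p) * (1 - 2 * q) ^ 2 := mul_nonneg (by linarith) (sq_nonneg _)
    rcases le_total q (3 / 4) with h | h
    · linarith
    · have h3 : (1 - p) * (1 / 4) ≤ (1 - p) * (1 - 2 * q) ^ 2 :=
        mul_le_mul_of_nonneg_left (by nlinarith) (by linarith)
      linarith
  rcases le_total p (1 / 4) with h | h
  · linarith [key p q hp0 h hq0 hq1]
  rcases le_total q (1 / 4) with h' | h'
  · linarith [key q p hq0 h' hp0 hp1]
  nlinarith [mul_le_mul h h' (by norm_num) (by linarith)]

/-- The single-coordinate inequality behind the corruption bound. -/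
theorem corruption_local {a0 a1 b0 b1 : ℝ} (ha0 : 0 ≤ a0) (ha1 : 0 ≤ a1) (hb0 : 0 ≤ b0)
    (hb1 : 0 ≤ b1) :
    (a0 + a1) * b0 + a0 * (b0 + b1) ≤ 24 * (a1 * b1) +
      96 * (((a0 - a1) / (a0 + a1)) ^ 2 * (a0 + a1) * b0 +
        a0 * (((b0 - b1) / (b0 + b1)) ^ 2 * (b0 + b1))) := by
  rcases (add_nonneg ha0 ha1).eq_or_lt with ha | ha
  · have h0 : a0 = 0 := by linarith
    have h1 : a1 = 0 := by linarith
    simp [h0, h1]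
  rcases (add_nonneg hb0 hb1).eq_or_lt with hb | hb
  · have h0 : b0 = 0 := by linarith
    have h1 : b1 = 0 := by linarith
    simp [h0, h1]
  have h := corruption_ratio_aux (p := a1 / (a0 + a1)) (q := b1 / (b0 + b1)) (by positivity)
    (by rw [div_le_one ha]; linarith) (by positivity) (by rw [div_le_one hb]; linarith)
  have h2 := mul_le_mul_of_nonneg_right h (mul_pos ha hb).le
  have e1 : 1 - a1 / (a0 + a1) = a0 / (a0 + a1) := by field_simp; ring
  have e2 : 1 - b1 / (b0 + b1) = b0 / (b0 + b1) := by field_simp; ring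
  have e3 : 1 - 2 * (a1 / (a0 + a1)) = (a0 - a1) / (a0 + a1) := by field_simp; ring
  have e4 : 1 - 2 * (b1 / (b0 + b1)) = (b0 - b1) / (b0 + b1) := by field_simp; ring
  have e5 : 2 - a1 / (a0 + a1) - b1 / (b0 + b1) = a0 / (a0 + a1) + b0 / (b0 + b1) := by
    rw [← e1, ← e2]; ring
  rw [e1, e2, e3, e4, e5] at h2
  have l : (a0 / (a0 + a1) + b0 / (b0 + b1)) * ((a0 + a1) * (b0 + b1))
      = (a0 + a1) * b0 + a0 * (b0 + b1) := by field_simp; ring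
  have r : (24 * (a1 / (a0 + a1) * (b1 / (b0 + b1))) + 96 * (b0 / (b0 + b1) *
      ((a0 - a1) / (a0 + a1)) ^ 2 + a0 / (a0 + a1) * ((b0 - b1) / (b0 + b1)) ^ 2)) *
      ((a0 + a1) * (b0 + b1)) = 24 * (a1 * b1) +
      96 * (((a0 - a1) / (a0 + a1)) ^ 2 * (a0 + a1) * b0 +
        a0 * (((b0 - b1) / (b0 + b1)) ^ 2 * (b0 + b1))) := by
    generalize (a0 - a1) / (a0 + a1) = u
    generalize (b0 - b1) / (b0 + b1) = w
    field_simp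
  rw [l, r] at h2
  exact h2

/-- The mean of `h` over random disjoint pairs: each point is assigned to one of the two players,
whose set contains it with probability one half. -/
noncomputable def disjointMean (h : Finset ι → Finset ι → ℝ) : ℝ :=
  𝔼 s : Finset ι, 𝔼 x : Finset ι, 𝔼 y : Finset ι, h (x ∩ s) (y ∩ sᶜ)

/-- The mean of `h` over random pairs meeting in the point `i`. -/
noncomputable def pointMean (i : ι) (h : Finset ι → Finset ι → ℝ) : ℝ :=
  𝔼 s : Finset ι, 𝔼 x : Finset ι, 𝔼 y : Finset ι, h (insert i (x ∩ s)) (insert i (y ∩ sᶜ))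

theorem disjointMean_mul (f g : Finset ι → ℝ) :
    disjointMean (fun x y => f x * g y) = 𝔼 s, subsetMean f s * subsetMean g sᶜ := by
  simp_rw [disjointMean, subsetMean, expect_mul, mul_expect]

theorem pointMean_mul (i : ι) (f g : Finset ι → ℝ) :
    pointMean i (fun x y => f x * g y) =
      𝔼 s, subsetMean (fun x => f (insert i x)) s * subsetMean (fun x => g (insert i x)) sᶜ := by
  simp_rw [pointMean, subsetMean, expect_mul, mul_expect]

theorem disjointMean_le_pointMean_add (i : ι) {f g : Finset ι → ℝ} (hf : ∀ x, 0 ≤ f x)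
    (hg : ∀ x, 0 ≤ g x) :
    disjointMean (fun x y => f x * g y) ≤ 6 * pointMean i (fun x y => f x * g y) +
      96 * 𝔼 s, ((subsetCoeff i f s / subsetMean f s) ^ 2 * subsetMean f s * subsetMean g sᶜ +
        subsetMean f s * ((subsetCoeff i g sᶜ / subsetMean g sᶜ) ^ 2 * subsetMean g sᶜ)) := by
  -- Pairing the splits that give `i` to one player or the other turns the claim into
  -- `corruption_local`, divided by 4.
  rw [disjointMean_mul, pointMean_mul, expect_eq_expect_insert_erase i,
    expect_eq_expect_insert_erase i (fun s => _ + _), mul_expect, mul_expect, ← expect_add_distrib]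
  refine expect_le_expect fun s _ => ?_
  simp only [compl_insert, compl_erase, subsetMean_insert, subsetMean_erase, subsetCoeff_insert,
    subsetCoeff_erase]
  have h := corruption_local (subsetMean_nonneg (fun x => hf (x.erase i)) s)
    (subsetMean_nonneg (fun x => hf (insert i x)) s)
    (subsetMean_nonneg (fun x => hg (x.erase i)) sᶜ)
    (subsetMean_nonneg (fun x => hg (insert i x)) sᶜ)
  have e : ∀ a b : ℝ, (a - b) / 2 / ((a + b) / 2) = (a - b) / (a + b) := fun a b => by
    rw [div_div_div_cancel_right₀ two_ne_zero]
  simp only [e, zero_div]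
  linarith

/-- The corruption inequality for combinatorial rectangles, in entropy form. -/
theorem card_mul_disjointMean_le {f g : Finset ι → ℝ} (hf0 : ∀ x, 0 ≤ f x) (hf1 : ∀ x, f x ≤ 1)
    (hg0 : ∀ x, 0 ≤ g x) (hg1 : ∀ x, g x ≤ 1) :
    Fintype.card ι * disjointMean (fun x y => f x * g y) ≤
      6 * ∑ i, pointMean i (fun x y => f x * g y) +
        192 * Real.negMulLog (disjointMean fun x y => f x * g y) := by
  have h1 := sum_le_sum fun i (_ : i ∈ univ) => disjointMean_le_pointMean_add i hf0 hg0
  rw [sum_const, nsmul_eq_mul, card_univ, sum_add_distrib, ← mul_sum, ← mul_sum,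
    ← expect_sum_comm] at h1
  have h2 : 𝔼 s : Finset ι, ∑ i, ((subsetCoeff i f s / subsetMean f s) ^ 2 * subsetMean f s *
      subsetMean g sᶜ + subsetMean f s *
      ((subsetCoeff i g sᶜ / subsetMean g sᶜ) ^ 2 * subsetMean g sᶜ)) ≤
      𝔼 s, 2 * Real.negMulLog (subsetMean f s * subsetMean g sᶜ) := by
    refine expect_le_expect fun s _ => ?_
    -- The product rule for `negMulLog` matches the two level-one bounds, one per player.
    rw [sum_add_distrib, ← sum_mul, ← mul_sum, Real.negMulLog_mul]
    have a := mul_le_mul_of_nonneg_right (sum_sq_subsetCoeff_le hf0 hf1 s)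
      (subsetMean_nonneg hg0 sᶜ)
    have b := mul_le_mul_of_nonneg_left (sum_sq_subsetCoeff_le hg0 hg1 sᶜ)
      (subsetMean_nonneg hf0 s)
    linarith
  have h3 : 𝔼 s : Finset ι, Real.negMulLog (subsetMean f s * subsetMean g sᶜ) ≤
      Real.negMulLog (𝔼 s, subsetMean f s * subsetMean g sᶜ) := by
    have := Real.concaveOn_negMulLog.le_map_sum (t := univ)
      (w := fun _ : Finset ι => (Fintype.card (Finset ι) : ℝ)⁻¹)
      (p := fun s => subsetMean f s * subsetMean g sᶜ) (fun _ _ => by positivity)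
      (by simp) (fun s _ => mul_nonneg (subsetMean_nonneg hf0 s) (subsetMean_nonneg hg0 sᶜ))
    simp only [smul_eq_mul, ← mul_sum] at this
    simpa only [Fintype.expect_eq_sum_div_card, div_eq_inv_mul] using this
  rw [← mul_expect] at h2
  rw [← disjointMean_mul] at h3
  linarith

/-- The corruption bound for combinatorial rectangles: a rectangle that is not exponentially small
contains a constant fraction of the pairs meeting in one point. -/
theorem disjointMean_le_mul_add_exp [Nonempty ι] {f g : Finset ι → ℝ} (hf0 : ∀ x, 0 ≤ f x)
    (hf1 : ∀ x, f x ≤ 1) (hg0 : ∀ x, 0 ≤ g x) (hg1 : ∀ x, g x ≤ 1) :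
    disjointMean (fun x y => f x * g y) ≤
      12 * (𝔼 i, pointMean i (fun x y => f x * g y)) +
        Real.exp (-(Fintype.card ι / 384)) := by
  have hU : 0 ≤ 𝔼 i, pointMean i (fun x y => f x * g y) := by
    refine expect_nonneg fun i _ => expect_nonneg fun s _ => expect_nonneg fun x _ =>
      expect_nonneg fun y _ => mul_nonneg (hf0 _) (hg0 _)
  have h := card_mul_disjointMean_le hf0 hf1 hg0 hg1
  set D := disjointMean fun x y => f x * g y
  have hN : (0 : ℝ) < Fintype.card ι := by exact_mod_cast Fintype.card_pos
  rcases le_total D (Real.exp (-(Fintype.card ι / 384))) with hD | hD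
  · linarith
  have hDpos : 0 < D := (Real.exp_pos _).trans_le hD
  have hlog := Real.log_le_log (Real.exp_pos _) hD
  rw [Real.log_exp] at hlog
  -- As 384 = 2 · 192, the entropy term takes up at most half of the left side.
  have h4 : Real.negMulLog D ≤ D * (Fintype.card ι / 384) := by
    rw [Real.negMulLog]; nlinarith
  have h5 : ∑ i, pointMean i (fun x y => f x * g y)
      = Fintype.card ι * 𝔼 i, pointMean i (fun x y => f x * g y) := by
    rw [Fintype.expect_eq_sum_div_card]; field_simp
  rw [h5] at h
  have h6 : Fintype.card ι * D ≤
      Fintype.card ι * (12 * 𝔼 i, pointMean i (fun x y => f x * g y)) := by linarith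
  linarith [le_of_mul_le_mul_left h6 hN, Real.exp_pos (-((Fintype.card ι : ℝ) / 384))]

end Cube

/-! ### From rectangles to randomized protocols -/

section Amplification

open Finset
open scoped BigOperators

variable {ι : Type*} [Fintype ι] [DecidableEq ι]

/-- The corruption functional: nonnegative, up to an exponentially small error, on rectangles. -/
noncomputable def corruptionGap :
    (Finset ι → Finset ι → ℝ) →ₗ[ℝ] ℝ where
  toFun h := 12 * (𝔼 i, pointMean i h) - disjointMean h
  map_add' h h' := by
    simp only [pointMean, disjointMean, Pi.add_apply, expect_add_distrib]; ring
  map_smul' c h := by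
    simp only [pointMean, disjointMean, Pi.smul_apply, smul_eq_mul, ← mul_expect, RingHom.id_apply]
    ring

/-- `h` satisfies the corruption bound with weight `W`, also after restriction to fractional
rectangles. -/
def CorruptionBound (W : ℝ) (h : Finset ι → Finset ι → ℝ) : Prop :=
  ∀ f g : Finset ι → ℝ, (∀ x, 0 ≤ f x) → (∀ x, f x ≤ 1) → (∀ x, 0 ≤ g x) → (∀ x, g x ≤ 1) →
    -(W * Real.exp (-(Fintype.card ι / 384))) ≤ corruptionGap fun x y => f x * h x y * g y

theorem corruptionBound_one [Nonempty ι] :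
    CorruptionBound (ι := ι) 1 fun _ _ => 1 := by
  intro f g hf0 hf1 hg0 hg1
  have := disjointMean_le_mul_add_exp hf0 hf1 hg0 hg1
  simp only [mul_one, one_mul, corruptionGap, LinearMap.coe_mk, AddHom.coe_mk]
  linarith

theorem CorruptionBound.mono {W W' : ℝ} {h : Finset ι → Finset ι → ℝ} (H : CorruptionBound W h)
    (hW : W ≤ W') : CorruptionBound W' h := fun f g hf0 hf1 hg0 hg1 =>
  (neg_le_neg (mul_le_mul_of_nonneg_right hW (Real.exp_pos _).le)).trans (H f g hf0 hf1 hg0 hg1)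

theorem CorruptionBound.zero {W : ℝ} (hW : 0 ≤ W) :
    CorruptionBound (ι := ι) W fun _ _ => 0 := by
  intro f g _ _ _ _
  have : (fun x y => f x * 0 * g y) = (0 : Finset ι → Finset ι → ℝ) := by ext; simp
  rw [this, map_zero]
  exact neg_nonpos.2 (mul_nonneg hW (Real.exp_pos _).le)

/-- Splitting by a bit of the first player. -/
theorem CorruptionBound.split_left {W₀ W₁ : ℝ} {h : Bool → Finset ι → Finset ι → ℝ}
    (H₀ : CorruptionBound W₀ (h false)) (H₁ : CorruptionBound W₁ (h true))
    (m : Finset ι → Bool) : CorruptionBound (W₀ + W₁) fun x y => h (m x) x y := by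
  intro f g hf0 hf1 hg0 hg1
  have key : ∀ b, (∀ x, 0 ≤ (if m x = b then f x else 0)) ∧
      ∀ x, (if m x = b then f x else 0) ≤ 1 := fun b =>
    ⟨fun x => by split_ifs; exacts [hf0 x, le_rfl],
      fun x => by split_ifs; exacts [hf1 x, zero_le_one]⟩
  -- The indicator of the bit is absorbed into `f`; this is why the bound quantifies over all
  -- fractional rectangles.
  have e : (fun x y => f x * h (m x) x y * g y) =
      (fun x y => (if m x = false then f x else 0) * h false x y * g y) +
        (fun x y => (if m x = true then f x else 0) * h true x y * g y) := by
    ext x y; cases hm : m x <;> simp [hm]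
  rw [e, map_add]
  have a := H₀ _ g (key false).1 (key false).2 hg0 hg1
  have b := H₁ _ g (key true).1 (key true).2 hg0 hg1
  linarith

/-- Splitting by a bit of the second player. -/
theorem CorruptionBound.split_right {W₀ W₁ : ℝ} {h : Bool → Finset ι → Finset ι → ℝ}
    (H₀ : CorruptionBound W₀ (h false)) (H₁ : CorruptionBound W₁ (h true))
    (m : Finset ι → Bool) : CorruptionBound (W₀ + W₁) fun x y => h (m y) x y := by
  intro f g hf0 hf1 hg0 hg1
  have key : ∀ b, (∀ x, 0 ≤ (if m x = b then g x else 0)) ∧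
      ∀ x, (if m x = b then g x else 0) ≤ 1 := fun b =>
    ⟨fun x => by split_ifs; exacts [hg0 x, le_rfl],
      fun x => by split_ifs; exacts [hg1 x, zero_le_one]⟩
  have e : (fun x y => f x * h (m y) x y * g y) =
      (fun x y => f x * h false x y * (if m y = false then g y else 0)) +
        (fun x y => f x * h true x y * (if m y = true then g y else 0)) := by
    ext x y; cases hm : m y <;> simp [hm]
  rw [e, map_add]
  have a := H₀ f _ hf0 hf1 (key false).1 (key false).2
  have b := H₁ f _ hf0 hf1 (key true).1 (key true).2
  linarith

variable {X Y : Type}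

/-- Restricting to the pairs rejected by a deterministic protocol of cost `c` multiplies the weight
by at most `2 ^ c`. -/
theorem CorruptionBound.mul_reject (u : Finset ι → X) (v : Finset ι → Y) {W : ℝ} (hW : 0 ≤ W)
    {h : Finset ι → Finset ι → ℝ} (H : CorruptionBound W h) (π : DetProtocol X Y) :
    CorruptionBound (2 ^ π.cost * W) fun x y =>
      (if π.run (u x) (v y) = false then 1 else 0) * h x y := by
  induction π with
  | output b =>
    cases b
    · simpa [DetProtocol.run, DetProtocol.cost] using H
    · simpa [DetProtocol.run, DetProtocol.cost] using CorruptionBound.zero hW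
  | alice msg next ih =>
    refine ((ih false).split_left (h := fun b x y =>
      (if (next b).run (u x) (v y) = false then 1 else 0) * h x y) (ih true)
      (fun x => msg (u x))).mono ?_
    rw [DetProtocol.cost, pow_succ]
    have a : (2 : ℝ) ^ (next false).cost ≤ 2 ^ max (next false).cost (next true).cost :=
      pow_le_pow_right₀ one_le_two (le_max_left _ _)
    have b : (2 : ℝ) ^ (next true).cost ≤ 2 ^ max (next false).cost (next true).cost :=
      pow_le_pow_right₀ one_le_two (le_max_right _ _)
    nlinarith
  | bob msg next ih =>
    refine ((ih false).split_right (h := fun b x y =>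
      (if (next b).run (u x) (v y) = false then 1 else 0) * h x y) (ih true)
      (fun y => msg (v y))).mono ?_
    rw [DetProtocol.cost, pow_succ]
    have a : (2 : ℝ) ^ (next false).cost ≤ 2 ^ max (next false).cost (next true).cost :=
      pow_le_pow_right₀ one_le_two (le_max_left _ _)
    have b : (2 : ℝ) ^ (next true).cost ≤ 2 ^ max (next false).cost (next true).cost :=
      pow_le_pow_right₀ one_le_two (le_max_right _ _)
    nlinarith

namespace PublicCoinProtocol

/-- The probability that the protocol answers `false`. -/
noncomputable def rejectProb (P : PublicCoinProtocol X Y) (x : X) (y : Y) : ℝ :=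
  (P.toOuterMeasure {π | π.run x y = false}).toReal

theorem hasSum_toReal (P : PublicCoinProtocol X Y) : HasSum (fun π => (P π).toReal) 1 := by
  have h := (ENNReal.summable_toReal P.tsum_coe_ne_top).hasSum
  rwa [← ENNReal.tsum_toReal_eq P.apply_ne_top, P.tsum_coe, ENNReal.toReal_one] at h

theorem hasSum_rejectProb (P : PublicCoinProtocol X Y) (x : X) (y : Y) :
    HasSum (fun π => (P π).toReal * (if π.run x y = false then 1 else 0)) (P.rejectProb x y) := by
  have e : (fun π => (P π).toReal * (if π.run x y = false then 1 else 0)) =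
      fun π => (({π | π.run x y = false} : Set (DetProtocol X Y)).indicator P π).toReal := by
    ext π; by_cases h : π.run x y = false <;> simp [h]
  have h := (ENNReal.summable_toReal
    (P.tsum_coe_indicator_ne_top {π | π.run x y = false})).hasSum
  rw [rejectProb, PMF.toOuterMeasure_apply, e, ENNReal.tsum_toReal_eq]
  · exact h
  · intro π
    exact ((Set.indicator_le_self _ _ _).trans_lt (P.apply_lt_top π)).ne

theorem rejectProb_le {P : PublicCoinProtocol X Y} {F : X → Y → Prop} {ε : ℝ} (hε : 0 ≤ ε)
    (hP : P.Decides F ε) {x : X} {y : Y} (hF : F x y) : P.rejectProb x y ≤ ε := by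
  have h := hP x y
  simp only [hF, iff_true, Bool.not_eq_true] at h
  exact ENNReal.toReal_le_of_le_ofReal hε h

theorem le_rejectProb {P : PublicCoinProtocol X Y} {F : X → Y → Prop} {ε : ℝ} (hε : 0 ≤ ε)
    (hP : P.Decides F ε) {x : X} {y : Y} (hF : ¬ F x y) : 1 - ε ≤ P.rejectProb x y := by
  have h := hP x y
  simp only [hF, iff_false, not_not] at h
  have h1 : 1 ≤ P.toOuterMeasure {π | π.run x y = false} +
      P.toOuterMeasure {π | π.run x y = true} := by
    refine le_trans ?_ (MeasureTheory.measure_union_le _ _)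
    rw [(P.toOuterMeasure_apply_eq_one_iff _).2]
    intro π _
    cases hr : π.run x y <;> simp [hr]
  have h2 := ENNReal.toReal_mono (ENNReal.add_ne_top.2
    ⟨?_, ne_top_of_le_ne_top ENNReal.ofReal_ne_top h⟩) h1
  · rw [ENNReal.toReal_one, ENNReal.toReal_add _ (ne_top_of_le_ne_top ENNReal.ofReal_ne_top h)] at h2
    · have := ENNReal.toReal_le_of_le_ofReal hε h
      rw [rejectProb]; linarith
    · rw [PMF.toOuterMeasure_apply]; exact P.tsum_coe_indicator_ne_top _
  · rw [PMF.toOuterMeasure_apply]; exact P.tsum_coe_indicator_ne_top _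

theorem rejectProb_nonneg (P : PublicCoinProtocol X Y) (x : X) (y : Y) : 0 ≤ P.rejectProb x y :=
  ENNReal.toReal_nonneg

end PublicCoinProtocol

/-- The rejection probability is a mixture of deterministic rejection indicators. The functional is
linear on a finite-dimensional space, hence continuous, so it passes through the possibly infinite
sum. -/
theorem CorruptionBound.mul_rejectProb (u : Finset ι → X) (v : Finset ι → Y) {W : ℝ} (hW : 0 ≤ W)
    {h : Finset ι → Finset ι → ℝ} (H : CorruptionBound W h) {P : PublicCoinProtocol X Y} {b : ℕ}
    (hP : P.CostAtMost b) :
    CorruptionBound (2 ^ b * W) fun x y => P.rejectProb (u x) (v y) * h x y := by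
  intro f g hf0 hf1 hg0 hg1
  have hs : HasSum (fun π => (P π).toReal • fun x y =>
      f x * ((if π.run (u x) (v y) = false then 1 else 0) * h x y) * g y)
      (fun x y => f x * (P.rejectProb (u x) (v y) * h x y) * g y) := by
    refine Pi.hasSum.2 fun x => Pi.hasSum.2 fun y => ?_
    have := (P.hasSum_rejectProb (u x) (v y)).mul_right (f x * h x y * g y)
    rw [show f x * (P.rejectProb (u x) (v y) * h x y) * g y =
      P.rejectProb (u x) (v y) * (f x * h x y * g y) by ring]
    refine Eq.mpr (congrArg (fun F => HasSum F _) (funext fun π => ?_)) this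
    simp only [Pi.smul_apply, smul_eq_mul]
    ring
  have hs' := hs.map (corruptionGap (ι := ι)) corruptionGap.continuous_of_finiteDimensional
  have hc := P.hasSum_toReal.mul_right (-(2 ^ b * W * Real.exp (-(Fintype.card ι / 384))))
  rw [one_mul] at hc
  refine hasSum_le (fun π => ?_) hc hs'
  simp only [Function.comp_apply, map_smul, smul_eq_mul]
  by_cases hπ : π ∈ P.support
  · refine mul_le_mul_of_nonneg_left ?_ ENNReal.toReal_nonneg
    exact ((H.mul_reject u v hW π).mono (mul_le_mul_of_nonneg_right
      (pow_le_pow_right₀ one_le_two (hP π hπ)) hW)) f g hf0 hf1 hg0 hg1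
  · simp [(P.apply_eq_zero_iff π).2 hπ]

/-- Each factor refines the rectangles by one more run, at a cost of `2 ^ b` in weight. -/
theorem corruptionBound_rejectProb_pow [Nonempty ι] (u : Finset ι → X) (v : Finset ι → Y)
    {P : PublicCoinProtocol X Y} {b : ℕ} (hP : P.CostAtMost b) (k : ℕ) :
    CorruptionBound (2 ^ (b * k)) fun x y => P.rejectProb (u x) (v y) ^ k := by
  induction k with
  | zero => simpa using corruptionBound_one (ι := ι)
  | succ k ih =>
    have := ih.mul_rejectProb u v (by positivity) hP
    simpa only [Nat.mul_succ, pow_add, pow_succ', mul_comm] using this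

/-- A protocol that separates disjoint pairs from pairs of sets meeting in exactly one point
satisfies a lower bound on its cost. -/
theorem pow_le_of_decides [Nonempty ι] (u : Finset ι → X) (v : Finset ι → Y) {F : X → Y → Prop}
    (hF₀ : ∀ x y, x ∩ y = ∅ → ¬ F (u x) (v y)) (hF₁ : ∀ x y i, x ∩ y = {i} → F (u x) (v y))
    {ε : ℝ} (hε₀ : 0 ≤ ε) (hε₁ : ε ≤ 1) {P : PublicCoinProtocol X Y} (hP : P.Decides F ε) {b : ℕ}
    (hb : P.CostAtMost b) (k : ℕ) :
    (1 - ε) ^ k ≤ 12 * ε ^ k + 2 ^ (b * k) * Real.exp (-(Fintype.card ι / 384)) := by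
  have h := corruptionBound_rejectProb_pow u v hb k (fun _ => 1) (fun _ => 1)
    (fun _ => zero_le_one) (fun _ => le_rfl) (fun _ => zero_le_one) (fun _ => le_rfl)
  simp only [mul_one, one_mul, corruptionGap, LinearMap.coe_mk, AddHom.coe_mk] at h
  have hD : (1 - ε) ^ k ≤ disjointMean fun x y => P.rejectProb (u x) (v y) ^ k := by
    refine le_expect univ_nonempty fun s _ => le_expect univ_nonempty fun x _ =>
      le_expect univ_nonempty fun y _ => pow_le_pow_left₀ (by linarith)
        (PublicCoinProtocol.le_rejectProb hε₀ hP (hF₀ _ _ ?_)) k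
    ext j; simp; tauto
  have hU : 𝔼 i, pointMean i (fun x y => P.rejectProb (u x) (v y) ^ k) ≤ ε ^ k := by
    refine expect_le univ_nonempty fun i _ => expect_le univ_nonempty fun s _ =>
      expect_le univ_nonempty fun x _ => expect_le univ_nonempty fun y _ =>
        pow_le_pow_left₀ (P.rejectProb_nonneg _ _)
        (PublicCoinProtocol.rejectProb_le hε₀ hP (hF₁ _ _ i ?_)) k
    ext j; simp; tauto
  linarith

/-- A protocol of cost zero cannot decide a nonconstant predicate with error below one half. -/
theorem PublicCoinProtocol.one_le_cost {F : X → Y → Prop} {x x' : X} {y y' : Y} (h₀ : ¬ F x y)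
    (h₁ : F x' y') {ε : ℝ} (hε₀ : 0 ≤ ε) (hε : ε < 1 / 2) {P : PublicCoinProtocol X Y}
    (hP : P.Decides F ε) {b : ℕ} (hb : P.CostAtMost b) : 1 ≤ b := by
  by_contra hlt
  have hrun : ∀ π ∈ P.support, π.run x y = π.run x' y' := by
    intro π hπ
    have := hb π hπ
    cases π with
    | output => rfl
    | alice => simp only [DetProtocol.cost] at this; omega
    | bob => simp only [DetProtocol.cost] at this; omega
  have e : P.rejectProb x y = P.rejectProb x' y' := by
    unfold rejectProb
    rw [P.toOuterMeasure_apply_eq_of_inter_support_eq]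
    ext π
    simp only [Set.mem_inter_iff, Set.mem_ofPred_eq, and_congr_left_iff]
    intro hπ
    rw [hrun π hπ]
  have a := le_rejectProb hε₀ hP h₀
  have b := rejectProb_le hε₀ hP h₁
  linarith

/-- Randomized communication lower bound for every predicate that contains unique disjointness,
with a constant depending only on the error. -/
theorem exists_cost_lower_bound {ε : ℝ} (hε₀ : 0 ≤ ε) (hε : ε < 1 / 2) :
    ∃ c : ℝ, 0 < c ∧ ∀ (ι X Y : Type) [Fintype ι] [DecidableEq ι] [Nonempty ι]
      (u : Finset ι → X) (v : Finset ι → Y) (F : X → Y → Prop),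
      (∀ x y, x ∩ y = ∅ → ¬ F (u x) (v y)) → (∀ x y i, x ∩ y = {i} → F (u x) (v y)) →
      ∀ (P : PublicCoinProtocol X Y) (b : ℕ), P.Decides F ε → P.CostAtMost b →
        c * Fintype.card ι ≤ b := by
  have h1ε : 0 < 1 - ε := by linarith
  -- With 24 = 2 · 12, the error term `12 * ε ^ k` is below half of `(1 - ε) ^ k`, leaving `K`.
  obtain ⟨k, hk⟩ := exists_pow_lt_of_lt_one (show (0 : ℝ) < 1 / 24 by norm_num)
    (show ε / (1 - ε) < 1 by rw [div_lt_one h1ε]; linarith)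
  rw [div_pow, div_lt_iff₀ (by positivity)] at hk
  set K := (1 - ε) ^ k / 2 with hK
  have hK0 : 0 < K := by positivity
  have hK1 : K < 1 := by
    have : (1 - ε) ^ k ≤ 1 := pow_le_one₀ h1ε.le (by linarith)
    linarith
  have hL : 0 < -Real.log K := neg_pos.2 (Real.log_neg hK0 hK1)
  have hl2 := Real.log_pos one_lt_two
  have hden : 0 < k * Real.log 2 + -Real.log K := by positivity
  refine ⟨1 / (384 * (k * Real.log 2 + -Real.log K)), by positivity, ?_⟩
  intro ι X Y _ _ _ u v F hF₀ hF₁ P b hP hb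
  have hmain := pow_le_of_decides u v hF₀ hF₁ hε₀ (by linarith) hP hb k
  -- Cost at least one absorbs the additive `-Real.log K` into a multiple of `b`.
  have hb1 : (1 : ℝ) ≤ b := by
    obtain ⟨i⟩ := ‹Nonempty ι›
    exact_mod_cast PublicCoinProtocol.one_le_cost (hF₀ ∅ ∅ (by simp))
      (hF₁ {i} {i} i (by simp)) hε₀ hε hP hb
  have h2 : K ≤ 2 ^ (b * k) * Real.exp (-(Fintype.card ι / 384)) := by linarith
  have h3 := Real.log_le_log hK0 h2
  rw [Real.log_mul (by positivity) (Real.exp_pos _).ne', Real.log_exp, Real.log_pow] at h3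
  push_cast at h3
  rw [div_mul_eq_mul_div, one_mul, div_le_iff₀ (by positivity)]
  nlinarith
end Amplification

/-! ### Reduction to bipartite matching -/

section Matching

theorem bipGraph_adj_inl_inr {n : ℕ} {E : BipEdges n} {i j : Fin n} :
    (bipGraph E).Adj (Sum.inl i) (Sum.inr j) ↔ (i, j) ∈ E := by
  simp [bipGraph]

theorem bipGraph_not_adj_inl {n : ℕ} {E : BipEdges n} {i j : Fin n} :
    ¬ (bipGraph E).Adj (Sum.inl i) (Sum.inl j) := by
  simp [bipGraph]

theorem bipGraph_not_adj_inr {n : ℕ} {E : BipEdges n} {i j : Fin n} :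
    ¬ (bipGraph E).Adj (Sum.inr i) (Sum.inr j) := by
  simp [bipGraph]

/-- A perfect matching of a bipartite graph is a permutation. -/
theorem exists_perm_of_isPerfectMatching {n : ℕ} {E : BipEdges n} {M : (bipGraph E).Subgraph}
    (hM : M.IsPerfectMatching) :
    ∃ σ : Equiv.Perm (Fin n), ∀ i j, M.Adj (Sum.inl i) (Sum.inr j) ↔ σ i = j := by
  rw [SimpleGraph.Subgraph.isPerfectMatching_iff] at hM
  have h1 : ∀ i : Fin n, ∃ j : Fin n, M.Adj (Sum.inl i) (Sum.inr j) := by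
    intro i
    obtain ⟨w, hw, -⟩ := hM (Sum.inl i)
    rcases w with j | j
    · exact (bipGraph_not_adj_inl hw.adj_sub).elim
    · exact ⟨j, hw⟩
  choose s hs using h1
  have hinj : Function.Injective s := by
    intro i i' h
    have h2 := hs i'
    rw [← h] at h2
    exact Sum.inl_injective ((hM (Sum.inr (s i))).unique (hs i).symm h2.symm)
  refine ⟨Equiv.ofBijective s (Finite.injective_iff_bijective.1 hinj), fun i j => ⟨fun h => ?_, ?_⟩⟩
  · exact Sum.inr_injective ((hM (Sum.inl i)).unique (hs i) h)
  · rintro rfl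
    exact hs i

/-- The perfect matching given by a permutation along the edges. -/
def permMatching {n : ℕ} {E : BipEdges n} (σ : Equiv.Perm (Fin n)) (hσ : ∀ i, (i, σ i) ∈ E) :
    (bipGraph E).Subgraph where
  verts := Set.univ
  Adj v w := (∃ i, v = Sum.inl i ∧ w = Sum.inr (σ i)) ∨ ∃ i, w = Sum.inl i ∧ v = Sum.inr (σ i)
  adj_sub := by
    rintro v w (⟨i, rfl, rfl⟩ | ⟨i, rfl, rfl⟩)
    · exact bipGraph_adj_inl_inr.2 (hσ i)
    · exact (bipGraph_adj_inl_inr.2 (hσ i)).symm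
  edge_vert _ := trivial
  symm := ⟨fun _ _ h => h.symm⟩

theorem permMatching_isPerfectMatching {n : ℕ} {E : BipEdges n} (σ : Equiv.Perm (Fin n))
    (hσ : ∀ i, (i, σ i) ∈ E) : (permMatching σ hσ).IsPerfectMatching := by
  rw [SimpleGraph.Subgraph.isPerfectMatching_iff]
  rintro (i | j)
  · refine ⟨Sum.inr (σ i), Or.inl ⟨i, rfl, rfl⟩, ?_⟩
    rintro w (⟨i', h, rfl⟩ | ⟨i', -, h⟩)
    · rw [Sum.inl_injective h]
    · cases h
  · refine ⟨Sum.inl (σ.symm j), Or.inr ⟨σ.symm j, rfl, by simp⟩, ?_⟩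
    rintro w (⟨i', h, -⟩ | ⟨i', rfl, h⟩)
    · cases h
    · rw [Sum.inr_injective h]; simp

theorem subgraph_bipGraph_ext {n : ℕ} {E : BipEdges n} {M M' : (bipGraph E).Subgraph}
    (hM : M.IsPerfectMatching) (hM' : M'.IsPerfectMatching)
    (h : ∀ i j, M.Adj (Sum.inl i) (Sum.inr j) ↔ M'.Adj (Sum.inl i) (Sum.inr j)) : M = M' := by
  refine SimpleGraph.Subgraph.ext
    ((Set.eq_univ_of_forall hM.2).trans (Set.eq_univ_of_forall hM'.2).symm) ?_
  ext v w
  rcases v with i | i <;> rcases w with j | j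
  · exact iff_of_false (fun h => bipGraph_not_adj_inl h.adj_sub)
      (fun h => bipGraph_not_adj_inl h.adj_sub)
  · exact h i j
  · rw [M.adj_comm, M'.adj_comm]; exact h j i
  · exact iff_of_false (fun h => bipGraph_not_adj_inr h.adj_sub)
      (fun h => bipGraph_not_adj_inr h.adj_sub)

theorem exists_perm_of_intersectionBPM {n : ℕ} {EA EB : BipEdges n} (h : IntersectionBPM EA EB) :
    ∃ σ : Equiv.Perm (Fin n), ∀ i, (i, σ i) ∈ EA ∩ EB := by
  obtain ⟨M, hM⟩ := h
  obtain ⟨σ, hσ⟩ := exists_perm_of_isPerfectMatching hM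
  exact ⟨σ, fun i => bipGraph_adj_inl_inr.1 ((hσ i _).2 rfl).adj_sub⟩

theorem intersectionUBPM_of_existsUnique_perm {n : ℕ} {EA EB : BipEdges n}
    (h : ∃! σ : Equiv.Perm (Fin n), ∀ i, (i, σ i) ∈ EA ∩ EB) : IntersectionUBPM EA EB := by
  obtain ⟨σ, hσ, huniq⟩ := h
  have key : ∀ M : (bipGraph (EA ∩ EB)).Subgraph, M.IsPerfectMatching →
      ∀ i j, M.Adj (Sum.inl i) (Sum.inr j) ↔ σ i = j := by
    intro M hM
    obtain ⟨τ, hτ⟩ := exists_perm_of_isPerfectMatching hM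
    have := huniq τ fun i => bipGraph_adj_inl_inr.1 ((hτ i _).2 rfl).adj_sub
    rwa [← this]
  refine ⟨permMatching σ hσ, permMatching_isPerfectMatching σ hσ, fun M hM => ?_⟩
  exact subgraph_bipGraph_ext hM (permMatching_isPerfectMatching σ hσ) fun i j =>
    (key M hM i j).trans (key _ (permMatching_isPerfectMatching σ hσ) i j).symm

/-- Two paths: the left vertices `m, m + 1, …` alternate with the right vertices `0, …, p`, and the
right vertices `p + 1, p + 2, …` alternate with the left vertices `0, …, m - 1`. -/
def TwoPaths (m p i j : ℕ) : Prop :=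
  (m ≤ i ∧ (j + m = i ∨ j + m = i + 1)) ∨ (p < j ∧ (j = i + p ∨ j = i + p + 1))

variable {n m p : ℕ}

/-- Hall violation: the first `m` left vertices see only the `m - 1` right vertices beyond `p`. -/
theorem not_forall_twoPaths (hn : m + p = n) (hm : 0 < m) (σ : Equiv.Perm (Fin n)) :
    ¬ ∀ i : Fin n, TwoPaths m p i (σ i) := by
  intro h
  have hp : ∀ i : Fin m, p < (σ ⟨i, by omega⟩ : Fin n).val := by
    intro i
    have := h ⟨i, by omega⟩
    simp only [TwoPaths] at this
    omega
  let f : Fin m → Fin (m - 1) := fun i =>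
    ⟨(σ ⟨i, by omega⟩ : Fin n).val - p - 1, by have := hp i; omega⟩
  have hf : Function.Injective f := by
    intro i i' hii
    have h1 := hp i
    have h2 := hp i'
    have h3 : (σ ⟨i, by omega⟩ : Fin n).val = (σ ⟨i', by omega⟩ : Fin n).val := by
      simp only [f, Fin.mk.injEq] at hii
      omega
    have h4 := congrArg Fin.val (σ.injective (Fin.ext h3))
    exact Fin.ext h4
  have := Fintype.card_le_of_injective f hf
  simp only [Fintype.card_fin] at this
  omega

/-- The unique permutation along the two paths and the edge `(a, b)` between them. -/
def twoPathsMatch (m p a b i : ℕ) : ℕ :=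
  if i < a then i + p + 1 else if i = a then b else if i < m then i + p else
    if i < b + m then i - m else i - m + 1

theorem exists_perm_twoPaths {a b : ℕ} (hn : m + p = n) (ha : a < m) (hb : b ≤ p) :
    ∃ σ : Equiv.Perm (Fin n), ∀ i : Fin n, TwoPaths m p i (σ i) ∨ (i.val = a ∧ (σ i).val = b) := by
  have hlt : ∀ i : Fin n, twoPathsMatch m p a b i < n := by
    intro i
    unfold twoPathsMatch
    split_ifs <;> omega
  let s : Fin n → Fin n := fun i => ⟨twoPathsMatch m p a b i, hlt i⟩
  have hs : Function.Injective s := by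
    intro i i' h
    simp only [s, Fin.mk.injEq, twoPathsMatch] at h
    apply Fin.ext
    split_ifs at h <;> omega
  refine ⟨Equiv.ofBijective s (Finite.injective_iff_bijective.1 hs), fun i => ?_⟩
  simp only [Equiv.ofBijective_apply, s, twoPathsMatch, TwoPaths]
  split_ifs <;> omega

/-- The edge `(a, b)` must be used. Deleting its ends leaves up to four path pieces, each matched by
peeling from an original path end: `low` and `high` on the right-surplus path, `left` and `right` on
the other. -/
theorem perm_eq_twoPathsMatch {a b : ℕ} (hn : m + p = n) (ha : a < m) (hb : b ≤ p)
    (σ : Equiv.Perm (Fin n))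
    (h : ∀ i : Fin n, TwoPaths m p i (σ i) ∨ (i.val = a ∧ (σ i).val = b)) (i : Fin n) :
    (σ i).val = twoPathsMatch m p a b i := by
  have hab : ∀ i : Fin n, i.val = a → (σ i).val = b := by
    by_contra! hne
    obtain ⟨i₀, hi₀, hne⟩ := hne
    refine not_forall_twoPaths hn (by omega) σ fun i => (h i).resolve_right fun hi => ?_
    have : i = i₀ := Fin.ext (hi.1.trans hi₀.symm)
    exact hne (this ▸ hi.2)
  have hinj : ∀ i i' : Fin n, (σ i).val = (σ i').val → i.val = i'.val := fun i i' h =>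
    congrArg Fin.val (σ.injective (Fin.ext h))
  have hsurj : ∀ k < n, ∃ i : Fin n, (σ i).val = k := fun k hk => ⟨σ.symm ⟨k, hk⟩, by simp⟩
  have h' : ∀ i : Fin n, (m ≤ i.val ∧ ((σ i).val + m = i ∨ (σ i).val + m = i + 1)) ∨
      (p < (σ i).val ∧ ((σ i).val = i + p ∨ (σ i).val = i + p + 1)) ∨
      (i.val = a ∧ (σ i).val = b) := by
    intro i
    have := h i
    simp only [TwoPaths] at this
    tauto
  -- Right vertex 0 has only the neighbour `m`; each later one has its other neighbour already
  -- taken.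
  have low : ∀ k < b, ∀ i : Fin n, i.val = m + k → (σ i).val = k := by
    intro k
    induction k with
    | zero =>
      intro hk i hi
      obtain ⟨j, hj⟩ := hsurj 0 (by omega)
      have := h' j
      have e : j = i := Fin.ext (by omega)
      exact e ▸ hj
    | succ k ih =>
      intro hk i hi
      obtain ⟨j, hj⟩ := hsurj (k + 1) (by omega)
      have h1 := h' j
      have h2 := ih (by omega) j
      have e : j = i := Fin.ext (by omega)
      exact e ▸ hj
  have high : ∀ d k, k + d = p → b < k → ∀ i : Fin n, i.val + 1 = m + k → (σ i).val = k := by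
    intro d
    induction d with
    | zero =>
      intro k hd hk i hi
      obtain ⟨j, hj⟩ := hsurj k (by omega)
      have := h' j
      have e : j = i := Fin.ext (by omega)
      exact e ▸ hj
    | succ d ih =>
      intro k hd hk i hi
      obtain ⟨j, hj⟩ := hsurj k (by omega)
      have h1 := h' j
      have h2 := ih (k + 1) (by omega) (by omega) j
      have e : j = i := Fin.ext (by omega)
      exact e ▸ hj
  have left : ∀ k < a, ∀ i : Fin n, i.val = k → (σ i).val = k + p + 1 := by
    intro k
    induction k with
    | zero => intro hk i hi; have := h' i; omega
    | succ k ih =>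
      intro hk i hi
      have h1 := h' i
      have h2 := ih (by omega) ⟨k, by omega⟩ rfl
      have h3 := hinj i ⟨k, by omega⟩
      dsimp only at h3
      omega
  have right : ∀ d k, k + d + 1 = m → a < k → ∀ i : Fin n, i.val = k → (σ i).val = k + p := by
    intro d
    induction d with
    | zero => intro k hd hk i hi; have := h' i; omega
    | succ d ih =>
      intro k hd hk i hi
      have h1 := h' i
      have h2 := ih (k + 1) (by omega) (by omega) ⟨k + 1, by omega⟩ rfl
      have h3 := hinj i ⟨k + 1, by omega⟩
      dsimp only at h3
      omega
  unfold twoPathsMatch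
  split_ifs with h1 h2 h3 h4
  · exact left i h1 i rfl
  · exact hab i h2
  · exact right (m - 1 - i) i (by omega) (by omega) i rfl
  · exact low (i - m) (by omega) i (by omega)
  · exact high (p - (i - m + 1)) (i - m + 1) (by omega) (by omega) i (by omega)

/-- The input graph encoding a set `x` of edges between the two paths. -/
def twoPathsEncode (n m p : ℕ) (x : Finset (Fin m × Fin (p + 1))) : BipEdges n :=
  {e | TwoPaths m p e.1 e.2 ∨ ∃ d ∈ x, d.1.val = e.1.val ∧ d.2.val = e.2.val}

theorem mem_twoPathsEncode_inter {x y : Finset (Fin m × Fin (p + 1))} {i j : Fin n} :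
    (i, j) ∈ twoPathsEncode n m p x ∩ twoPathsEncode n m p y ↔
      TwoPaths m p i j ∨ ∃ d ∈ x ∩ y, d.1.val = i.val ∧ d.2.val = j.val := by
  constructor
  · rintro ⟨h | ⟨d, hd, h1, h2⟩, h' | ⟨d', hd', h1', h2'⟩⟩
    · exact Or.inl h
    · exact Or.inl h
    · exact Or.inl h'
    · have : d' = d := Prod.ext (Fin.ext (h1'.trans h1.symm)) (Fin.ext (h2'.trans h2.symm))
      exact Or.inr ⟨d, Finset.mem_inter.2 ⟨hd, this ▸ hd'⟩, h1, h2⟩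
  · rintro (h | ⟨d, hd, h⟩)
    · exact ⟨Or.inl h, Or.inl h⟩
    · rw [Finset.mem_inter] at hd
      exact ⟨Or.inr ⟨d, hd.1, h⟩, Or.inr ⟨d, hd.2, h⟩⟩

theorem not_intersectionBPM_twoPathsEncode (hn : m + p = n) (hm : 0 < m)
    {x y : Finset (Fin m × Fin (p + 1))} (hxy : x ∩ y = ∅) :
    ¬ IntersectionBPM (twoPathsEncode n m p x) (twoPathsEncode n m p y) := by
  intro h
  obtain ⟨σ, hσ⟩ := exists_perm_of_intersectionBPM h
  refine not_forall_twoPaths hn hm σ fun i => ?_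
  have := mem_twoPathsEncode_inter.1 (hσ i)
  simpa [hxy] using this

theorem intersectionUBPM_twoPathsEncode (hn : m + p = n) {x y : Finset (Fin m × Fin (p + 1))}
    {d : Fin m × Fin (p + 1)} (hxy : x ∩ y = {d}) :
    IntersectionUBPM (twoPathsEncode n m p x) (twoPathsEncode n m p y) := by
  have hd : ∀ i j : Fin n, (i, j) ∈ twoPathsEncode n m p x ∩ twoPathsEncode n m p y ↔
      TwoPaths m p i j ∨ (i.val = d.1 ∧ j.val = d.2) := fun i j => by
    rw [mem_twoPathsEncode_inter, hxy]
    simp [eq_comm]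
  apply intersectionUBPM_of_existsUnique_perm
  simp only [hd]
  obtain ⟨σ, hσ⟩ := exists_perm_twoPaths hn d.1.isLt (Nat.lt_succ_iff.1 d.2.isLt)
  refine ⟨σ, hσ, fun τ hτ => Equiv.ext fun i => Fin.ext ?_⟩
  rw [perm_eq_twoPathsMatch hn d.1.isLt (Nat.lt_succ_iff.1 d.2.isLt) τ hτ,
    perm_eq_twoPathsMatch hn d.1.isLt (Nat.lt_succ_iff.1 d.2.isLt) σ hσ]

end Matching

theorem mainTheorem7 (ε : ℝ) (hε₀ : 0 ≤ ε) (hε : ε < 1 / 2) :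
    ∃ c : ℝ, 0 < c ∧ ∀ n : ℕ,
      (∀ (P : PublicCoinProtocol (BipEdges n) (BipEdges n)) (b : ℕ),
        P.Decides IntersectionBPM ε → P.CostAtMost b → c * (n : ℝ) ^ 2 ≤ b) ∧
      (∀ (P : PublicCoinProtocol (BipEdges n) (BipEdges n)) (b : ℕ),
        P.Decides IntersectionUBPM ε → P.CostAtMost b → c * (n : ℝ) ^ 2 ≤ b) := by
  obtain ⟨c, hc, hbound⟩ := exists_cost_lower_bound hε₀ hε
  refine ⟨c / 4, by positivity, fun n => ?_⟩
  rcases Nat.eq_zero_or_pos n with rfl | hpos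
  · simp
  -- A balanced split makes the number `m * (p + 1)` of candidate edges at least a quarter of n².
  obtain ⟨m, p, hn, hm, hmp⟩ : ∃ m p : ℕ, m + p = n ∧ 0 < m ∧ n ^ 2 ≤ 4 * (m * (p + 1)) := by
    refine ⟨(n + 1) / 2, n / 2, by omega, by omega, ?_⟩
    rcases Nat.even_or_odd' n with ⟨k, rfl | rfl⟩
    · rw [show (2 * k + 1) / 2 = k by omega, show 2 * k / 2 = k by omega]; nlinarith
    · rw [show (2 * k + 1 + 1) / 2 = k + 1 by omega, show (2 * k + 1) / 2 = k by omega]; nlinarith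
  have : Nonempty (Fin m × Fin (p + 1)) := ⟨⟨⟨0, hm⟩, 0⟩⟩
  have hcard : c / 4 * (n : ℝ) ^ 2 ≤ c * Fintype.card (Fin m × Fin (p + 1)) := by
    have h : (n : ℝ) ^ 2 ≤ 4 * Fintype.card (Fin m × Fin (p + 1)) := by
      simp only [Fintype.card_prod, Fintype.card_fin]
      exact_mod_cast hmp
    nlinarith
  refine ⟨fun P b hP hb => hcard.trans ?_, fun P b hP hb => hcard.trans ?_⟩
  · exact hbound _ _ _ (twoPathsEncode n m p) (twoPathsEncode n m p) _
      (fun x y h => not_intersectionBPM_twoPathsEncode hn hm h)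
      (fun x y d h => (intersectionUBPM_twoPathsEncode hn h).exists) P b hP hb
  · exact hbound _ _ _ (twoPathsEncode n m p) (twoPathsEncode n m p) _
      (fun x y h h' => not_intersectionBPM_twoPathsEncode hn hm h h'.exists)
      (fun x y d h => intersectionUBPM_twoPathsEncode hn h) P b hP hb
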